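/- Let $N\ge 1$ and $d\ge 0$ be integers and let $\mathcal A=(a_{i_1,\dots,i_N})\in\mathbb R^{d\times\cdots\times d}$ be a real tensor of order $N$ all of whose modes have size $d$. Write $\|\mathcal A\|_F^2=\sum_{i_1,\dots,i_N}a_{i_1,\dots,i_N}^2$ and $\operatorname{tr}(\mathcal A)=\sum_{j=1}^d a_{j,\dots,j}$. Let $g^{(1)},\dots,g^{(N-1)}$ be random vectors in $\mathbb R^d$ whose $(N-1)d$ entries are i.i.d. Rademacher (equal to $+1$ or $-1$ with probability $1/2$ each), let $g=g^{(1)}*\cdots*g^{(N-1)}$ be their entrywise product (the all-ones vector if $N=1$), and let $$X=g^{T}\bigl(\mathcal A\,\bar\times_1 g^{(1)}\,\bar\times_2\cdots\bar\times_{N-1}g^{(N-1)}\bigr)=\sum_{p=1}^d g_p\sum_{j_1,\dots,j_{N-1}=1}^d a_{j_1,\dots,j_{N-1},p}\prod_{t=1}^{N-1}g^{(t)}_{j_t},$$ where $\bar\times_n$ denotes mode-$n$ tensor-vector multiplication. Then $X$ is square-integrable, and $$\operatorname{Var}(X)=\|\mathcal A\|_F^2-\operatorname{tr}(\mathcal A)^2+2\sum_{p>q}\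 \sum_{\substack{(j_1,\dots,j_{N-1}),\,(k_1,\dots,k_{N-1})\in\{p,q\}^{N-1}\\ j_t\ne k_t\ \text{for all } t}}a_{j_1,\dots,j_{N-1},p}\,a_{k_1,\dots,k_{N-1},q}\ \le\ 2\Bigl(\|\mathcal A\|_F^2-\sum_{j=1}^d a_{j,\dots,j}^2\Bigr).$$ Further, there is an absolute constant $C>0$ (independent of $N$, $d$, $\mathcal A$, $\varepsilon$, $\delta$ and $K$) such that the following holds whenever $\operatorname{tr}(\mathcal A)\ne 0$, $\varepsilon>0$ and $0<\delta<1$. If $K\ge 1$ is an integer with $$K\ \ge\ C\,\frac{\bigl(\|\mathcal A\|_F^2-\sum_{j=1}^d a_{j,\dots,j}^2\bigr)\,\bigl(2+\log(1/\delta)\bigr)^{2(N-1)}}{\varepsilon^2\operatorname{tr}(\mathcal A)^2},$$ where $\log$ is the natural logarithm, and $X_1,\dots,X_K$ are $K$ such estimates computed from $K$ mutually independent sets of vectors $g^{(1)},\dots,g^{(N-1)}$ with i.i.d. Rademacher entries, then $\bar X=\frac1K\sum_{k=1}^K X_k$ is an $(\varepsilon,\delta)$-approximation of $\operatorname{tr}(\mathcal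 A)$, that is, $$\Pr\bigl(|\bar X-\operatorname{tr}(\mathcal A)|\le\varepsilon\,|\operatorname{tr}(\mathcal A)|\bigr)\ge 1-\delta.$$ -/

import Mathlib

open MeasureTheory ProbabilityTheory Finset

universe u

/-- Real tensors of order `N` all of whose modes have size `d`, given by their entries. -/
abbrev CubeTensor (N d : ℕ) : Type := (Fin N → Fin d) → ℝ

namespace CubeTensor

variable {N n d : ℕ}

/-- The Frobenius norm. -/
noncomputable def frobeniusNorm (A : CubeTensor N d) : ℝ := √(∑ i : Fin N → Fin d, A i ^ 2)

/-- The diagonal entry `a_{i,…,i}`. -/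
def diagEntry (A : CubeTensor N d) (i : Fin d) : ℝ := A (fun _ => i)

/-- The trace: the sum of the diagonal entries. -/
def trace (A : CubeTensor N d) : ℝ := ∑ i, A.diagEntry i

/-- The entry `a_{j_1,…,j_n,p}` of a tensor of order `n + 1`. -/
def entry (A : CubeTensor (n + 1) d) (j : Fin n → Fin d) (p : Fin d) : ℝ :=
  A (Fin.snoc (α := fun _ => Fin d) j p)

/-- Mode-`k` tensor-vector multiplication: the `k`-th index is summed against `x`. -/
def modeMul (A : CubeTensor (n + 1) d) (k : Fin (n + 1)) (x : Fin d → ℝ) : CubeTensor n d :=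
  fun i => ∑ j : Fin d, A (Fin.insertNth (α := fun _ => Fin d) k j i) * x j

/-- The vector obtained from a tensor of order `n + 1` by multiplying its modes `1, …, n` by the
vectors `x 0, …, x (n - 1)` respectively. Once the first mode has been contracted, the original
second mode is the first mode of the remaining tensor, and so on. -/
def contract : {n : ℕ} → CubeTensor (n + 1) d → (Fin n → Fin d → ℝ) → Fin d → ℝ
  | 0, A, _ => fun i => A (fun _ => i)
  | _ + 1, A, x => contract (A.modeMul 0 (x 0)) (fun t => x t.succ)

/-- The trace estimate `gᵀ (A ×₁ g⁽¹⁾ ×₂ ⋯ ×ₙ g⁽ⁿ⁾)` with `g = g⁽¹⁾ * ⋯ * g⁽ⁿ⁾` the entrywise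
product. -/
def traceEstimate (A : CubeTensor (n + 1) d) (g : Fin n → Fin d → ℝ) : ℝ :=
  (∏ t, g t) ⬝ᵥ A.contract g

/-- The sum of the products `a_{j,p} a_{k,q}` over `p > q` and all `j, k ∈ {p,q}^n` that differ in
every coordinate. -/
def crossSum (A : CubeTensor (n + 1) d) : ℝ :=
  ∑ p : Fin d, ∑ q : Fin d with q < p,
    ∑ jk : (Fin n → Fin d) × (Fin n → Fin d)
        with (∀ t, jk.1 t = p ∨ jk.1 t = q) ∧ (∀ t, jk.2 t = p ∨ jk.2 t = q) ∧
          ∀ t, jk.1 t ≠ jk.2 t,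
      A.entry jk.1 p * A.entry jk.2 q

end CubeTensor

/-- The Rademacher distribution: the values `1` and `-1`, each with probability `1/2`. -/
noncomputable def rademacherLaw : Measure ℝ :=
  (1 / 2 : ENNReal) • Measure.dirac 1 + (1 / 2 : ENNReal) • Measure.dirac (-1)

/-- The family `Y` of random variables is i.i.d. Rademacher under `μ`. -/
structure IsIIDRademacher {Ω ι : Type*} [MeasurableSpace Ω] (Y : ι → Ω → ℝ) (μ : Measure Ω) :
    Prop where
  law : ∀ i, HasLaw (Y i) rademacherLaw μ
  indep : iIndepFun Y μ

/-- `X` is an `(ε, δ)`-approximation of `ξ`: the relative error is at most `ε` with probability at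
least `1 - δ`. -/
def IsApproximation {Ω : Type*} [MeasurableSpace Ω] (X : Ω → ℝ) (ξ ε δ : ℝ) (μ : Measure Ω) :
    Prop :=
  1 - δ ≤ μ.real {ω | |X ω - ξ| ≤ ε * |ξ|}

open scoped BigOperators

/-! Only finitely many signs occur, so every expectation is a uniform average over a sign cube. In
the monomial of the multi-index `(j, p)` the squares cancel wherever `j t = p`, which leaves a Walsh
function whose `support` is the set of surviving variables; Walsh functions are orthonormal. Empty
support means a diagonal index, so the mean is the trace. Two indices with distinct last coordinates
p, q have equal support exactly when {j_t, k_t} = {p, q} for every t (`support_eq_support_iff`),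
which gives the variance formula. A nonempty support belongs to at most two indices
(`card_filter_support_eq_le`), so Cauchy–Schwarz gives the upper bound with its factor 2.

For the tail, the centred average of K copies is a polynomial of degree at most 2n in independent
signs. Bonami's inequality (`expect_sum_walsh_pow_le`) bounds its 2r-th moment by ((2r - 1)^(2n) V /
K)^r, where V is the upper bound on the variance. Markov's inequality with 2r close to log(1/δ)
turns this into the condition on K. -/

/-- The sign `±1` encoded by a Boolean. -/
def boolSign (b : Bool) : ℝ := if b then 1 else -1

theorem boolSign_mul_self (b : Bool) : boolSign b * boolSign b = 1 := by
  cases b <;> simp [boolSign]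

theorem boolSign_not (b : Bool) : boolSign (!b) = -boolSign b := by
  cases b <;> simp [boolSign]

/-! ### Walsh functions and their orthonormality -/

section Cube

variable {ι : Type*}

/-- The Walsh function `∏ i ∈ S, ε i` on the sign cube. -/
def walsh (S : Finset ι) (ε : ι → Bool) : ℝ := ∏ i ∈ S, boolSign (ε i)

theorem walsh_empty (ε : ι → Bool) : walsh ∅ ε = 1 := by simp [walsh]

theorem walsh_mul_self (S : Finset ι) (ε : ι → Bool) : walsh S ε * walsh S ε = 1 := by
  simp [walsh, ← prod_mul_distrib, boolSign_mul_self]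

variable [DecidableEq ι]

theorem walsh_insert {S : Finset ι} {i : ι} (hi : i ∉ S) (ε : ι → Bool) :
    walsh (insert i S) ε = boolSign (ε i) * walsh S ε := by
  simp [walsh, prod_insert hi]

/-- The involution of the sign cube that flips the sign `i`. -/
def flipSign (i : ι) : Equiv.Perm (ι → Bool) where
  toFun ε := Function.update ε i (!ε i)
  invFun ε := Function.update ε i (!ε i)
  left_inv ε := by simp
  right_inv ε := by simp

theorem walsh_flipSign_of_notMem {S : Finset ι} {i : ι} (hi : i ∉ S) (ε : ι → Bool) :
    walsh S (flipSign i ε) = walsh S ε := by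
  refine prod_congr rfl fun j hj => ?_
  have : j ≠ i := fun h => hi (h ▸ hj)
  simp [flipSign, this]

theorem walsh_flipSign_of_mem {S : Finset ι} {i : ι} (hi : i ∈ S) (ε : ι → Bool) :
    walsh S (flipSign i ε) = -walsh S ε := by
  rw [← insert_erase hi, walsh_insert (notMem_erase i S), walsh_insert (notMem_erase i S),
    walsh_flipSign_of_notMem (notMem_erase i S)]
  simp [flipSign, boolSign_not]

variable [Fintype ι]

theorem expect_flipSign (i : ι) (F : (ι → Bool) → ℝ) :
    𝔼 ε, F (flipSign i ε) = 𝔼 ε, F ε :=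
  Fintype.expect_equiv (flipSign i) _ _ fun _ => rfl

/-- If S ≠ T, flipping a sign in their symmetric difference negates the product, so its average is
its own negative. -/
theorem expect_walsh_mul_walsh (S T : Finset ι) :
    𝔼 ε, walsh S ε * walsh T ε = if S = T then 1 else 0 := by
  split_ifs with h
  · subst h
    simp [walsh_mul_self]
  · obtain ⟨i, hi⟩ : ∃ i, ¬(i ∈ S ↔ i ∈ T) := by
      by_contra! h'
      exact h (Finset.ext h')
    have key : ∀ ε, walsh S (flipSign i ε) * walsh T (flipSign i ε) =
        -(walsh S ε * walsh T ε) := by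
      intro ε
      by_cases hS : i ∈ S <;> by_cases hT : i ∈ T
      · exact absurd (iff_of_true hS hT) hi
      · rw [walsh_flipSign_of_mem hS, walsh_flipSign_of_notMem hT]; ring
      · rw [walsh_flipSign_of_notMem hS, walsh_flipSign_of_mem hT]; ring
      · exact absurd (iff_of_false hS hT) hi
    have := expect_flipSign i fun ε => walsh S ε * walsh T ε
    simp only [key, expect_neg_distrib] at this
    linarith

theorem expect_walsh (S : Finset ι) : 𝔼 ε, walsh S ε = if S = ∅ then 1 else 0 := by
  simpa [walsh_empty] using expect_walsh_mul_walsh S ∅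

end Cube

/-! ### The two-point inequality and Minkowski's inequality -/

theorem Nat.choose_two_mul_le (r k : ℕ) :
    (2 * r).choose (2 * k) ≤ (2 * r - 1) ^ k * r.choose k := by
  induction k with
  | zero => simp
  | succ k ih =>
    rcases le_or_gt r k with hrk | hrk
    · rw [Nat.choose_eq_zero_of_lt (show 2 * r < 2 * (k + 1) by omega)]
      exact Nat.zero_le _
    have h1 := Nat.choose_succ_right_eq (2 * r) (2 * k)
    have h2 := Nat.choose_succ_right_eq (2 * r) (2 * k + 1)
    have h3 := Nat.choose_succ_right_eq r k
    obtain ⟨m, rfl⟩ : ∃ m, r = k + 1 + m := ⟨r - (k + 1), by omega⟩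
    rw [show 2 * (k + 1 + m) - 2 * k = 2 * (m + 1) by omega] at h1
    rw [show 2 * (k + 1 + m) - (2 * k + 1) = 2 * m + 1 by omega] at h2
    rw [show k + 1 + m - k = m + 1 by omega] at h3
    rw [show 2 * (k + 1 + m) - 1 = 2 * k + 2 * m + 1 by omega] at ih ⊢
    rw [show 2 * (k + 1) = 2 * k + 1 + 1 by ring]
    set N := 2 * (k + 1 + m)
    have e : N.choose (2 * k + 1 + 1) * ((2 * k + 2) * (2 * k + 1)) =
        N.choose (2 * k) * (2 * (m + 1)) * (2 * m + 1) := by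
      rw [← h1, mul_right_comm, ← h2]; ring
    -- With r = k + 1 + m, passing from k to k + 1 multiplies the left side by (m+1)(2m+1) /
    -- ((k+1)(2k+1)) and the right side by (2r-1)(m+1) / (k+1), so 2m + 1 ≤ (2r-1)(2k+1) suffices.
    refine Nat.le_of_mul_le_mul_right (c := (2 * k + 2) * (2 * k + 1)) ?_ (by positivity)
    rw [e]
    calc N.choose (2 * k) * (2 * (m + 1)) * (2 * m + 1)
        ≤ ((2 * k + 2 * m + 1) ^ k * (k + 1 + m).choose k) * (2 * (m + 1)) *
          ((2 * k + 2 * m + 1) * (2 * k + 1)) := by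
          gcongr
          nlinarith [Nat.zero_le (k * m), Nat.zero_le (k * k)]
      _ = (2 * k + 2 * m + 1) ^ k * ((k + 1 + m).choose k * (m + 1)) * 2 *
          ((2 * k + 2 * m + 1) * (2 * k + 1)) := by ring
      _ = _ := by rw [← h3]; ring

theorem sum_range_two_mul_add_one_of_odd_eq_zero (f : ℕ → ℝ) (hf : ∀ k, f (2 * k + 1) = 0)
    (r : ℕ) : ∑ m ∈ range (2 * r + 1), f m = ∑ k ∈ range (r + 1), f (2 * k) := by
  induction r with
  | zero => simp
  | succ r ih =>
    rw [sum_range_succ _ (r + 1), ← ih, show 2 * (r + 1) + 1 = 2 * r + 1 + 1 + 1 by ring,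
      sum_range_succ, sum_range_succ, hf, show 2 * (r + 1) = 2 * r + 1 + 1 by ring]
    ring

/-- The two-point hypercontractive inequality for even moments. -/
theorem add_pow_add_sub_pow_le (a b : ℝ) (r : ℕ) :
    (a + b) ^ (2 * r) + (a - b) ^ (2 * r) ≤
      2 * (a ^ 2 + ((2 * r - 1 : ℕ) : ℝ) * b ^ 2) ^ r := by
  -- Odd powers of b cancel; the even ones are compared term by term with the binomial expansion of
  -- the right side.
  rw [add_comm a b, sub_eq_add_neg, add_comm a (-b), add_comm (a ^ 2), add_pow, add_pow, add_pow,
    ← sum_add_distrib, sum_range_two_mul_add_one_of_odd_eq_zero, mul_sum]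
  · refine sum_le_sum fun k hk => ?_
    have hk' : k ≤ r := Nat.lt_succ_iff.mp (mem_range.mp hk)
    have h := Nat.choose_two_mul_le r k
    have h' : ((2 * r).choose (2 * k) : ℝ) ≤ ((2 * r - 1 : ℕ) : ℝ) ^ k * (r.choose k : ℝ) := by
      exact_mod_cast h
    have e : 2 * r - 2 * k = 2 * (r - k) := by omega
    rw [e, pow_mul (-b), neg_sq, mul_pow, ← pow_mul, ← pow_mul]
    have : 0 ≤ b ^ (2 * k) * a ^ (2 * (r - k)) := by
      rw [pow_mul, pow_mul]; positivity
    nlinarith [mul_le_mul_of_nonneg_left h' this]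
  · intro k
    rw [Odd.neg_pow ⟨k, rfl⟩]
    ring

/-- A form of Minkowski's inequality for uniform averages. -/
theorem expect_add_mul_pow_le {κ : Type*} [Fintype κ] [Nonempty κ] {u v : κ → ℝ}
    (hu : ∀ x, 0 ≤ u x) (hv : ∀ x, 0 ≤ v x) {α β : ℝ} (hα : 0 ≤ α) (hβ : 0 ≤ β)
    {r : ℕ} (hr : r ≠ 0) (hu' : 𝔼 x, u x ^ r ≤ α ^ r) (hv' : 𝔼 x, v x ^ r ≤ β ^ r) :
    𝔼 x, (u x + v x) ^ r ≤ (α + β) ^ r := by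
  have hr1 : (1 : ℝ) ≤ r := by exact_mod_cast Nat.one_le_iff_ne_zero.mpr hr
  have hc : (0 : ℝ) < Fintype.card κ := by exact_mod_cast Fintype.card_pos
  -- Passing from averages to sums costs the same factor card^(1/r) for u and v; its r-th power is
  -- the normalisation of the average.
  have root : ∀ (w : κ → ℝ) (γ : ℝ), (∀ x, 0 ≤ w x) → 0 ≤ γ → 𝔼 x, w x ^ r ≤ γ ^ r →
      (∑ x, w x ^ (r : ℝ)) ^ (1 / (r : ℝ)) ≤ (Fintype.card κ : ℝ) ^ (1 / (r : ℝ)) * γ := by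
    intro w γ hw hγ h
    rw [Fintype.expect_eq_sum_div_card, div_le_iff₀ hc] at h
    simp only [Real.rpow_natCast]
    calc (∑ x, w x ^ r) ^ (1 / (r : ℝ)) ≤ (γ ^ r * Fintype.card κ) ^ (1 / (r : ℝ)) :=
          Real.rpow_le_rpow (sum_nonneg fun x _ => pow_nonneg (hw x) r) h (by positivity)
      _ = _ := by
          rw [Real.mul_rpow (by positivity) hc.le, one_div, Real.pow_rpow_inv_natCast hγ hr,
            mul_comm]
  have key := Real.Lp_add_le_of_nonneg univ hr1 (fun x _ => hu x) fun x _ => hv x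
  have h1 := key.trans (add_le_add (root u α hu hα hu') (root v β hv hβ hv'))
  rw [← mul_add] at h1
  have hs : 0 ≤ ∑ x, (u x + v x) ^ (r : ℝ) :=
    sum_nonneg fun x _ => Real.rpow_nonneg (add_nonneg (hu x) (hv x)) _
  have h2 := pow_le_pow_left₀ (Real.rpow_nonneg hs _) h1 r
  rw [mul_pow, one_div, Real.rpow_inv_natCast_pow hs hr, Real.rpow_inv_natCast_pow hc.le hr] at h2
  rw [Fintype.expect_eq_sum_div_card, div_le_iff₀ hc, mul_comm]
  simpa only [Real.rpow_natCast] using h2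

/-! ### Hypercontractivity on the sign cube -/

section Hypercontractivity

variable {ι : Type*} [DecidableEq ι] [Fintype ι]

/-- The Bonami inequality for even moments, in weighted form. -/
theorem expect_sum_walsh_pow_le (r : ℕ) (hr : r ≠ 0) (s : Finset ι) (c : Finset ι → ℝ) :
    𝔼 ε, (∑ S ∈ s.powerset, c S * walsh S ε) ^ (2 * r) ≤
      (∑ S ∈ s.powerset, ((2 * r - 1 : ℕ) : ℝ) ^ #S * c S ^ 2) ^ r := by
  induction s using Finset.induction_on generalizing c with
  | empty => simp [walsh_empty, pow_mul]
  | insert i s hi ih =>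
    set q : ℝ := ((2 * r - 1 : ℕ) : ℝ)
    have hq : 0 ≤ q := Nat.cast_nonneg _
    -- The function is split as a + ε_i b with a and b independent of the sign ε_i.
    set a : (ι → Bool) → ℝ := fun ε => ∑ S ∈ s.powerset, c S * walsh S ε
    set b : (ι → Bool) → ℝ := fun ε => ∑ S ∈ s.powerset, c (insert i S) * walsh S ε
    have hmem : ∀ S ∈ s.powerset, i ∉ S := fun S hS h => hi (mem_powerset.mp hS h)
    have hf : ∀ ε, ∑ S ∈ (insert i s).powerset, c S * walsh S ε =
        a ε + boolSign (ε i) * b ε := by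
      intro ε
      rw [sum_powerset_insert hi, mul_sum]
      congr 1
      refine sum_congr rfl fun S hS => ?_
      rw [walsh_insert (hmem S hS)]; ring
    have ha : ∀ ε, a (flipSign i ε) = a ε := fun ε =>
      sum_congr rfl fun S hS => by rw [walsh_flipSign_of_notMem (hmem S hS)]
    have hb : ∀ ε, b (flipSign i ε) = b ε := fun ε =>
      sum_congr rfl fun S hS => by rw [walsh_flipSign_of_notMem (hmem S hS)]
    have hflip := expect_flipSign i fun ε => (a ε + boolSign (ε i) * b ε) ^ (2 * r)
    have hsign : ∀ ε : ι → Bool, boolSign (flipSign i ε i) = -boolSign (ε i) := fun ε => by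
      simp [flipSign, boolSign_not]
    simp only [ha, hb, hsign] at hflip
    -- Adjoining i to S costs exactly one factor q, the one in the two-point inequality; this is why
    -- the weighted form passes through the induction.
    have hsum : ∑ S ∈ (insert i s).powerset, q ^ #S * c S ^ 2 =
        ∑ S ∈ s.powerset, q ^ #S * c S ^ 2 +
          q * ∑ S ∈ s.powerset, q ^ #S * c (insert i S) ^ 2 := by
      rw [sum_powerset_insert hi, mul_sum]
      congr 1
      refine sum_congr rfl fun S hS => ?_
      rw [card_insert_of_notMem (hmem S hS)]; ring
    rw [hsum]
    simp only [hf]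
    calc 𝔼 ε, (a ε + boolSign (ε i) * b ε) ^ (2 * r)
        ≤ 𝔼 ε, (a ε ^ 2 + q * b ε ^ 2) ^ r := by
          -- Averaging over the flip of ε_i reduces the claim to the two-point inequality at each
          -- point.
          have h : 𝔼 ε, ((a ε + boolSign (ε i) * b ε) ^ (2 * r) +
              (a ε + -boolSign (ε i) * b ε) ^ (2 * r)) ≤
              𝔼 ε, 2 * (a ε ^ 2 + q * b ε ^ 2) ^ r := by
            refine expect_le_expect fun ε _ => ?_
            have h := add_pow_add_sub_pow_le (a ε) (boolSign (ε i) * b ε) r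
            rw [mul_pow, sq (boolSign _), boolSign_mul_self, one_mul] at h
            simpa only [neg_mul, ← sub_eq_add_neg] using h
          rw [expect_add_distrib, hflip, ← mul_expect] at h
          linarith
      _ ≤ _ := by
          -- Minkowski's inequality in L^r for a² and q b², each controlled by the induction
          -- hypothesis.
          refine expect_add_mul_pow_le (fun _ => sq_nonneg _) (fun _ => by positivity)
            (sum_nonneg fun _ _ => by positivity)
            (mul_nonneg hq (sum_nonneg fun _ _ => by positivity)) hr ?_ ?_
          · simpa only [← pow_mul] using ih c
          · simp only [mul_pow q, ← mul_expect]
            gcongr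
            simpa only [← pow_mul] using ih fun S => c (insert i S)

/-- Hypercontractivity for even moments of a combination of distinct Walsh functions of degree at
most `m`. -/
theorem expect_walsh_combination_pow_le {τ : Type*} [Fintype τ] (r : ℕ) (hr : r ≠ 0) (m : ℕ)
    (f : τ → Finset ι) (hf : Function.Injective f) (c : τ → ℝ)
    (hm : ∀ x, c x ≠ 0 → #(f x) ≤ m) :
    𝔼 ε, (∑ x, c x * walsh (f x) ε) ^ (2 * r) ≤
      (((2 * r - 1 : ℕ) : ℝ) ^ m * ∑ x, c x ^ 2) ^ r := by
  classical
  have transfer : ∀ G : Finset ι → ℝ → ℝ, (∀ S, G S 0 = 0) →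
      ∑ S ∈ (univ : Finset ι).powerset, G S (Function.extend f c 0 S) = ∑ x, G (f x) (c x) := by
    intro G hG
    rw [powerset_univ, ← sum_subset (subset_univ (univ.image f)), sum_image (hf.injOn)]
    · simp [hf.extend_apply]
    · intro S _ hS
      rw [Function.extend_apply' _ _ _ (by simpa using hS)]
      exact hG S
  have h := expect_sum_walsh_pow_le r hr (univ : Finset ι) (Function.extend f c 0)
  -- The weights q^#S may be enlarged to q^m because q ≥ 1; this needs r ≠ 0, as the truncated 2r -
  -- 1 vanishes at r = 0.
  have q1 : (1 : ℝ) ≤ ((2 * r - 1 : ℕ) : ℝ) := by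
    exact_mod_cast (by omega : 1 ≤ 2 * r - 1)
  simp only [fun ε => transfer (fun S x => x * walsh S ε) (by simp)] at h
  rw [transfer (fun S x => ((2 * r - 1 : ℕ) : ℝ) ^ #S * x ^ 2) (by simp)] at h
  refine h.trans ?_
  rw [mul_sum]
  refine pow_le_pow_left₀ (sum_nonneg fun _ _ => by positivity) (sum_le_sum fun x _ => ?_) r
  by_cases hx : c x = 0
  · simp [hx]
  · gcongr
    exact hm x hx

end Hypercontractivity

/-! ### From Rademacher variables to averages over the cube -/

section Transfer

variable {ι : Type*} [Fintype ι]

/-- The law of a fair coin. -/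
noncomputable def coinLaw : Measure Bool :=
  (1 / 2 : ENNReal) • Measure.dirac true + (1 / 2 : ENNReal) • Measure.dirac false

instance : IsProbabilityMeasure coinLaw := ⟨by simp [coinLaw, ENNReal.inv_two_add_inv_two]⟩

theorem map_boolSign_coinLaw : coinLaw.map boolSign = rademacherLaw := by
  have h : Measurable boolSign := measurable_of_finite _
  rw [coinLaw, Measure.map_add _ _ h, Measure.map_smul, Measure.map_smul,
    Measure.map_dirac' h, Measure.map_dirac' h]
  simp [rademacherLaw, boolSign]

theorem coinLaw_singleton (b : Bool) : coinLaw {b} = 1 / 2 := by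
  cases b <;> simp [coinLaw]

theorem integral_pi_coinLaw [DecidableEq ι] (F : (ι → Bool) → ℝ) :
    ∫ ε, F ε ∂(Measure.pi fun _ : ι => coinLaw) = 𝔼 ε, F ε := by
  rw [integral_fintype .of_finite, Fintype.expect_eq_sum_div_card, sum_div]
  refine sum_congr rfl fun ε _ => ?_
  rw [measureReal_def, Measure.pi_singleton]
  simp [coinLaw_singleton, div_eq_inv_mul]

theorem IsIIDRademacher.hasLaw {Ω : Type*} [MeasurableSpace Ω] {μ : Measure Ω}
    [IsProbabilityMeasure μ] {Y : ι → Ω → ℝ} (h : IsIIDRademacher Y μ) :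
    HasLaw (fun ω i => Y i ω)
      ((Measure.pi fun _ : ι => coinLaw).map fun ε i => boolSign (ε i)) μ := by
  have : IsProbabilityMeasure (coinLaw.map boolSign) :=
    Measure.isProbabilityMeasure_map (measurable_of_finite _).aemeasurable
  rw [Measure.pi_map_pi fun _ => (measurable_of_finite _).aemeasurable]
  simp only [map_boolSign_coinLaw]
  exact h.indep.hasLaw_pi h.law

end Transfer

section Transfer

variable {ι Ω : Type*} [Fintype ι] [MeasurableSpace Ω] {μ : Measure Ω}
  [IsProbabilityMeasure μ] {Y : ι → Ω → ℝ}

theorem IsIIDRademacher.memLp_comp (h : IsIIDRademacher Y μ) {F : (ι → ℝ) → ℝ}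
    (hF : Measurable F) (p : ENNReal) : MemLp (fun ω => F fun i => Y i ω) p μ := by
  have hL := h.hasLaw
  have hs : Measurable fun (ε : ι → Bool) i => boolSign (ε i) := measurable_of_finite _
  refine (memLp_map_measure_iff (f := fun ω i => Y i ω) hF.aestronglyMeasurable
    hL.aemeasurable).mp ?_
  rw [hL.map_eq, memLp_map_measure_iff hF.aestronglyMeasurable hs.aemeasurable]
  exact .of_discrete

variable [DecidableEq ι]

theorem IsIIDRademacher.integral_comp (h : IsIIDRademacher Y μ) {F : (ι → ℝ) → ℝ}
    (hF : Measurable F) :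
    ∫ ω, F (fun i => Y i ω) ∂μ = 𝔼 ε : ι → Bool, F fun i => boolSign (ε i) := by
  have hs : Measurable fun (ε : ι → Bool) i => boolSign (ε i) := measurable_of_finite _
  have := h.hasLaw.integral_comp hF.aestronglyMeasurable
  rw [Function.comp_def] at this
  rw [this, integral_map hs.aemeasurable hF.aestronglyMeasurable, integral_pi_coinLaw]

theorem IsIIDRademacher.variance_comp (h : IsIIDRademacher Y μ) {F : (ι → ℝ) → ℝ}
    (hF : Measurable F) :
    variance (fun ω => F fun i => Y i ω) μ =
      (𝔼 ε : ι → Bool, (F fun i => boolSign (ε i)) ^ 2) -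
        (𝔼 ε : ι → Bool, F fun i => boolSign (ε i)) ^ 2 := by
  rw [variance_eq_sub (h.memLp_comp hF 2), h.integral_comp hF]
  congr 1
  exact h.integral_comp (hF.pow_const 2)

/-- Markov's inequality for the even moments of a function of Rademacher variables. -/
theorem IsIIDRademacher.measureReal_lt_abs_le (h : IsIIDRademacher Y μ) {F : (ι → ℝ) → ℝ}
    (hF : Measurable F) (r : ℕ) {t : ℝ} (ht : 0 < t) :
    μ.real {ω | t < |F fun i => Y i ω|} ≤
      (𝔼 ε : ι → Bool, (F fun i => boolSign (ε i)) ^ (2 * r)) / t ^ (2 * r) := by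
  have hint : Integrable (fun ω => (F fun i => Y i ω) ^ (2 * r)) μ :=
    memLp_one_iff_integrable.mp (h.memLp_comp (hF.pow_const (2 * r)) 1)
  have hm := mul_meas_ge_le_integral_of_nonneg
    (ae_of_all μ fun ω => (even_two_mul r).pow_nonneg (F fun i => Y i ω)) hint (t ^ (2 * r))
  rw [h.integral_comp (hF.pow_const (2 * r))] at hm
  rw [le_div_iff₀ (by positivity), mul_comm]
  refine le_trans ?_ hm
  refine mul_le_mul_of_nonneg_left (measureReal_mono fun ω hω => ?_) (by positivity)
  have hω' : t < |F fun i => Y i ω| := hω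
  show t ^ (2 * r) ≤ (F fun i => Y i ω) ^ (2 * r)
  rw [← (even_two_mul r).pow_abs (F fun i => Y i ω)]
  gcongr

end Transfer

/-! ### Walsh expansion and second moment of the trace estimate -/

namespace CubeTensor

variable {n d : ℕ}

theorem contract_eq_sum (A : CubeTensor (n + 1) d) (x : Fin n → Fin d → ℝ) (p : Fin d) :
    A.contract x p = ∑ j : Fin n → Fin d, A.entry j p * ∏ t, x t (j t) := by
  induction n with
  | zero =>
    simp only [contract, Fintype.sum_unique, entry, univ_eq_empty, prod_empty, mul_one]
    congr 1
  | succ n ih =>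
    rw [contract, ih, ← (Fin.consEquiv fun _ => Fin d).sum_comp, Fintype.sum_prod_type,
      sum_comm]
    refine sum_congr rfl fun j _ => ?_
    simp only [entry, modeMul, Fin.consEquiv, Equiv.coe_fn_mk, Fin.prod_univ_succ,
      Fin.cons_zero, Fin.cons_succ, sum_mul, ← Fin.cons_snoc_eq_snoc_cons, Fin.insertNth_zero']
    exact sum_congr rfl fun _ _ => by ring

theorem sum_entry {β : Type*} [AddCommMonoid β] (A : CubeTensor (n + 1) d) (G : ℝ → β) :
    ∑ p, ∑ j, G (A.entry j p) = ∑ i, G (A i) := by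
  rw [← (Fin.snocEquiv fun _ => Fin d).sum_comp, Fintype.sum_prod_type]
  rfl

theorem entry_const (A : CubeTensor (n + 1) d) (p : Fin d) :
    A.entry (fun _ => p) p = A.diagEntry p := by
  rw [entry, diagEntry]
  congr 1
  ext i
  refine Fin.lastCases ?_ (fun i => ?_) i <;> simp

/-- The set of the variables that survive in the product of `g t p * g t (j t)` over `t`, when
squares are cancelled; the index `(p, j)` stands for the multi-index `(j, p)`. -/
def support (I : Fin d × (Fin n → Fin d)) : Finset (Fin n × Fin d) :=
  univ.filter fun x => ¬(x.2 = I.1 ↔ x.2 = I.2 x.1)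

theorem mem_support {I : Fin d × (Fin n → Fin d)} {x : Fin n × Fin d} :
    x ∈ support I ↔ ¬(x.2 = I.1 ↔ x.2 = I.2 x.1) := by simp [support]

theorem prod_boolSign_eq_walsh (I : Fin d × (Fin n → Fin d)) (ε : Fin n × Fin d → Bool) :
    ∏ t, (boolSign (ε (t, I.1)) * boolSign (ε (t, I.2 t))) = walsh (support I) ε := by
  rw [walsh, support, prod_filter, Fintype.prod_prod_type]
  refine prod_congr rfl fun t _ => ?_
  have h : ∀ i, (if ¬(i = I.1 ↔ i = I.2 t) then boolSign (ε (t, i)) else 1) =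
      (if i = I.1 then boolSign (ε (t, i)) else 1) *
        (if i = I.2 t then boolSign (ε (t, i)) else 1) := by
    intro i
    by_cases h1 : i = I.1 <;> by_cases h2 : i = I.2 t <;> simp [h1, h2, boolSign_mul_self]
  simp only [h, prod_mul_distrib, prod_ite_eq', mem_univ, if_true]

/-- The entry at the multi-index `(j, p)` for `I = (p, j)`. -/
def coeff (A : CubeTensor (n + 1) d) (I : Fin d × (Fin n → Fin d)) : ℝ := A.entry I.2 I.1

theorem traceEstimate_eq_sum (A : CubeTensor (n + 1) d) (g : Fin n → Fin d → ℝ) :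
    A.traceEstimate g =
      ∑ I : Fin d × (Fin n → Fin d), A.coeff I * ∏ t, (g t I.1 * g t (I.2 t)) := by
  simp only [traceEstimate, dotProduct, Finset.prod_apply, contract_eq_sum, coeff,
    Fintype.sum_prod_type, mul_sum, prod_mul_distrib]
  exact sum_congr rfl fun p _ => sum_congr rfl fun j _ => by ring

theorem measurable_traceEstimate (A : CubeTensor (n + 1) d) :
    Measurable fun y : Fin n × Fin d → ℝ => A.traceEstimate fun t i => y (t, i) := by
  simp only [traceEstimate_eq_sum]
  fun_prop

theorem traceEstimate_boolSign (A : CubeTensor (n + 1) d) (ε : Fin n × Fin d → Bool) :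
    (A.traceEstimate fun t i => boolSign (ε (t, i))) =
      ∑ I, A.coeff I * walsh (support I) ε := by
  simp only [traceEstimate_eq_sum, prod_boolSign_eq_walsh]

theorem support_eq_empty_iff {I : Fin d × (Fin n → Fin d)} :
    support I = ∅ ↔ I.2 = fun _ => I.1 := by
  constructor
  · intro h
    ext1 t
    have := mem_support.not.mp (h ▸ notMem_empty (t, I.1))
    simpa [eq_comm] using this
  · intro h
    ext x
    simp [mem_support, h]

/-- In slot t the support is the symmetric difference of {p} and {j_t}. Equating it with that of {q}
and {k_t} amounts to {p} ∆ {q} = {j_t} ∆ {k_t}, that is, {j_t, k_t} = {p, q} since p ≠ q. -/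
theorem support_eq_support_iff {I J : Fin d × (Fin n → Fin d)} (hne : I.1 ≠ J.1) :
    support I = support J ↔
      (∀ t, I.2 t = I.1 ∨ I.2 t = J.1) ∧ (∀ t, J.2 t = I.1 ∨ J.2 t = J.1) ∧
        ∀ t, I.2 t ≠ J.2 t := by
  obtain ⟨p, j⟩ := I
  obtain ⟨q, k⟩ := J
  have h : support (p, j) = support (q, k) ↔
      ∀ t i, ((i = p ↔ i = j t) ↔ (i = q ↔ i = k t)) := by
    simp [Finset.ext_iff, mem_support, not_iff_not]
  rw [h, ← forall_and, ← forall_and]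
  refine forall_congr' fun t => ?_
  dsimp only at hne ⊢
  constructor
  · intro h
    have hp := h p
    have hq := h q
    grind
  · grind

theorem eq_of_support_eq {I J : Fin d × (Fin n → Fin d)} (h : support I = support J)
    (hp : I.1 = J.1) : I = J := by
  obtain ⟨p, j⟩ := I
  obtain ⟨q, k⟩ := J
  obtain rfl : p = q := hp
  have h' : ∀ t i, (i = j t ↔ i = k t) := fun t i => by
    have := Finset.ext_iff.mp h (t, i)
    simp only [mem_support] at this
    tauto
  congr 1
  ext1 t
  exact (h' t _).mp rfl

theorem card_support_le (I : Fin d × (Fin n → Fin d)) : #(support I) ≤ 2 * n := by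
  have hsub : support I ⊆ univ.image (fun t : Fin n => (t, I.1)) ∪
      univ.image fun t : Fin n => (t, I.2 t) := by
    rintro ⟨t, i⟩ hx
    rw [mem_support] at hx
    simp only [mem_union, mem_image, mem_univ, true_and, Prod.mk.injEq, exists_eq_left]
    grind
  refine (card_le_card hsub).trans ((card_union_le _ _).trans ?_)
  have h1 := card_image_le (s := (univ : Finset (Fin n))) (f := fun t => (t, I.1))
  have h2 := card_image_le (s := (univ : Finset (Fin n))) (f := fun t => (t, I.2 t))
  simp only [card_univ, Fintype.card_fin] at h1 h2
  omega

/-- Take (t, i) in S and an index I = (p, j) with support S; then p ≠ j_t. Any other last coordinate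
with the same support must equal j_t, and the support together with the last coordinate determines
the index. The empty support is excluded because all d diagonal indices share it. -/
theorem card_filter_support_eq_le {S : Finset (Fin n × Fin d)} (hS : S ≠ ∅) :
    #{I : Fin d × (Fin n → Fin d) | support I = S} ≤ 2 := by
  rcases Finset.eq_empty_or_nonempty {I : Fin d × (Fin n → Fin d) | support I = S} with h | ⟨I, hI⟩
  · simp [h]
  have hI : support I = S := by simpa using hI
  obtain ⟨⟨t, i⟩, hx⟩ := nonempty_iff_ne_empty.mpr hS
  have hx' := hx
  rw [← hI, mem_support] at hx'
  have hmaps : ∀ J ∈ ({J : Fin d × (Fin n → Fin d) | support J = S} : Finset _),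
      J.1 ∈ ({I.1, I.2 t} : Finset (Fin d)) := by
    intro J hJ
    have hJ : support J = S := by simpa using hJ
    by_contra hn
    simp only [mem_insert, mem_singleton, not_or] at hn
    have hs : support I = support J := hI.trans hJ.symm
    have := (support_eq_support_iff (Ne.symm hn.1)).mp hs
    grind
  refine (card_le_card_of_injOn Prod.fst hmaps ?_).trans card_le_two
  intro J hJ J' hJ' h
  have hJ : support J = S := by simpa using hJ
  have hJ' : support J' = S := by simpa using hJ'
  exact eq_of_support_eq (hJ.trans hJ'.symm) h

/-- The coefficient of `walsh S` in the trace estimate. -/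
def walshCoeff (A : CubeTensor (n + 1) d) (S : Finset (Fin n × Fin d)) : ℝ :=
  ∑ I with support I = S, A.coeff I

theorem walshCoeff_empty (A : CubeTensor (n + 1) d) : A.walshCoeff ∅ = A.trace := by
  simp only [walshCoeff, support_eq_empty_iff, sum_filter, Fintype.sum_prod_type, trace, coeff,
    sum_ite_eq', mem_univ, if_true, entry_const]

theorem traceEstimate_eq_sum_walsh (A : CubeTensor (n + 1) d) (ε : Fin n × Fin d → Bool) :
    (A.traceEstimate fun t i => boolSign (ε (t, i))) = ∑ S, A.walshCoeff S * walsh S ε := by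
  rw [traceEstimate_boolSign, ← sum_fiberwise univ support]
  refine sum_congr rfl fun S _ => ?_
  rw [walshCoeff, sum_mul]
  exact sum_congr rfl fun I hI => by rw [(mem_filter.mp hI).2]

theorem frobeniusNorm_sq (A : CubeTensor (n + 1) d) :
    A.frobeniusNorm ^ 2 = ∑ I, A.coeff I ^ 2 := by
  rw [frobeniusNorm, Real.sq_sqrt (sum_nonneg fun _ _ => sq_nonneg _), Fintype.sum_prod_type]
  exact (A.sum_entry (· ^ 2)).symm

theorem frobeniusNorm_sq_sub_sum_diagEntry_sq (A : CubeTensor (n + 1) d) :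
    A.frobeniusNorm ^ 2 - ∑ j, A.diagEntry j ^ 2 =
      ∑ I with support I ≠ ∅, A.coeff I ^ 2 := by
  have h : ∑ j, A.diagEntry j ^ 2 = ∑ I with support I = ∅, A.coeff I ^ 2 := by
    simp only [support_eq_empty_iff, sum_filter, Fintype.sum_prod_type, coeff,
      sum_ite_eq', mem_univ, if_true, entry_const]
  rw [frobeniusNorm_sq, h, ← sum_filter_add_sum_filter_not univ fun I => support I = ∅]
  ring

/-- Cauchy–Schwarz on each fibre of `support`; the factor 2 is the maximal size of a fibre over a
nonempty set. -/
theorem sum_walshCoeff_sq_le (A : CubeTensor (n + 1) d) :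
    ∑ S with S ≠ ∅, A.walshCoeff S ^ 2 ≤
      2 * (A.frobeniusNorm ^ 2 - ∑ j, A.diagEntry j ^ 2) := by
  rw [frobeniusNorm_sq_sub_sum_diagEntry_sq, sum_filter, sum_filter,
    ← sum_fiberwise univ support, mul_sum]
  refine sum_le_sum fun S _ => ?_
  split_ifs with hS
  · refine sq_sum_le_card_mul_sum_sq.trans ?_
    have e : ∑ I with support I = S, (if support I ≠ ∅ then A.coeff I ^ 2 else 0) =
        ∑ I with support I = S, A.coeff I ^ 2 :=
      sum_congr rfl fun I hI => if_pos (by rwa [(mem_filter.mp hI).2])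
    rw [e]
    gcongr
    exact_mod_cast card_filter_support_eq_le hS
  · exact mul_nonneg zero_le_two (sum_nonneg fun I _ => by split_ifs <;> positivity)

theorem expect_traceEstimate (A : CubeTensor (n + 1) d) :
    𝔼 ε : Fin n × Fin d → Bool, (A.traceEstimate fun t i => boolSign (ε (t, i))) = A.trace := by
  simp only [traceEstimate_eq_sum_walsh, expect_sum_comm, ← mul_expect, expect_walsh, mul_ite,
    mul_one, mul_zero, sum_ite_eq', mem_univ, if_true, walshCoeff_empty]

/-- This form, with equal supports left uncollected, serves the exact variance; the collected form
below serves the upper bound. -/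
theorem expect_traceEstimate_sq (A : CubeTensor (n + 1) d) :
    𝔼 ε : Fin n × Fin d → Bool, (A.traceEstimate fun t i => boolSign (ε (t, i))) ^ 2 =
      ∑ I, ∑ J, if support I = support J then A.coeff I * A.coeff J else 0 := by
  simp only [traceEstimate_boolSign, sq, sum_mul_sum, expect_sum_comm, mul_mul_mul_comm,
    ← mul_expect, expect_walsh_mul_walsh, mul_ite, mul_one, mul_zero]

theorem expect_traceEstimate_sq_eq_sum_walshCoeff (A : CubeTensor (n + 1) d) :
    𝔼 ε : Fin n × Fin d → Bool, (A.traceEstimate fun t i => boolSign (ε (t, i))) ^ 2 =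
      ∑ S, A.walshCoeff S ^ 2 := by
  have h : ∀ S T (ε : Fin n × Fin d → Bool),
      A.walshCoeff S * walsh S ε * (A.walshCoeff T * walsh T ε) =
        A.walshCoeff S * A.walshCoeff T * (walsh S ε * walsh T ε) :=
    fun _ _ _ => mul_mul_mul_comm _ _ _ _
  simp only [traceEstimate_eq_sum_walsh, sq, sum_mul_sum, expect_sum_comm, h,
    ← mul_expect, expect_walsh_mul_walsh, mul_ite, mul_one, mul_zero, sum_ite_eq, mem_univ,
    if_true]

theorem crossSum_eq (A : CubeTensor (n + 1) d) :
    A.crossSum = ∑ p, ∑ q, if q < p then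
      ∑ j, ∑ k, if support (p, j) = support (q, k) then A.coeff (p, j) * A.coeff (q, k) else 0
      else 0 := by
  simp only [crossSum, sum_filter, Fintype.sum_prod_type]
  refine sum_congr rfl fun p _ => sum_congr rfl fun q _ => ?_
  split_ifs with hqp
  · refine sum_congr rfl fun j _ => sum_congr rfl fun k _ => ?_
    simp only [support_eq_support_iff (I := (p, j)) (J := (q, k)) hqp.ne', coeff]
  · rfl

/-- For p = q the support determines the index, so only squares remain; the parts p > q and p < q
agree by symmetry. -/
theorem sum_support_eq_support (A : CubeTensor (n + 1) d) :
    (∑ I, ∑ J, if support I = support J then A.coeff I * A.coeff J else 0) =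
      A.frobeniusNorm ^ 2 + 2 * A.crossSum := by
  set G : Fin d → Fin d → ℝ := fun p q => ∑ j : Fin n → Fin d, ∑ k : Fin n → Fin d,
    if support (p, j) = support (q, k) then A.coeff (p, j) * A.coeff (q, k) else 0
  have hsymm : ∀ p q, G p q = G q p := by
    intro p q
    simp only [G]
    rw [sum_comm]
    refine sum_congr rfl fun k _ => sum_congr rfl fun j _ => ?_
    simp only [eq_comm (a := support (p, j)), mul_comm (A.coeff (p, j))]
  have hdiag : ∀ p, G p p = ∑ j, A.coeff (p, j) ^ 2 := by
    intro p
    refine sum_congr rfl fun j _ => ?_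
    rw [sum_eq_single j]
    · simp [sq]
    · intro k _ hk
      refine if_neg fun h => hk ?_
      exact (Prod.ext_iff.mp (eq_of_support_eq h rfl)).2.symm
    · simp
  have hsplit : ∀ p q, G p q = (if q = p then G p q else 0) +
      ((if q < p then G p q else 0) + if p < q then G p q else 0) := by
    intro p q
    rcases lt_trichotomy q p with h | h | h
    · simp [h, h.ne, h.not_gt]
    · simp [h]
    · simp [h, h.ne', h.not_gt]
  have hl : (∑ I, ∑ J, if support I = support J then A.coeff I * A.coeff J else 0) =
      ∑ p, ∑ q, G p q := by
    rw [Fintype.sum_prod_type]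
    refine sum_congr rfl fun p _ => ?_
    simp only [G, Fintype.sum_prod_type]
    exact sum_comm
  have hc : A.crossSum = ∑ p, ∑ q, if q < p then G p q else 0 := A.crossSum_eq
  have hc' : A.crossSum = ∑ p, ∑ q, if p < q then G p q else 0 := by
    rw [hc, sum_comm]
    exact sum_congr rfl fun p _ => sum_congr rfl fun q _ => by rw [hsymm]
  rw [hl, sum_congr rfl fun p _ => sum_congr rfl fun q _ => hsplit p q]
  simp only [sum_add_distrib, sum_ite_eq', mem_univ, if_true, hdiag]
  rw [← hc, ← hc', frobeniusNorm_sq, Fintype.sum_prod_type]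
  ring

end CubeTensor

/-! ### Moments of the average and the tail bound -/

namespace CubeTensor

variable {n d : ℕ}

theorem card_le_of_walshCoeff_ne_zero {A : CubeTensor (n + 1) d} {S : Finset (Fin n × Fin d)}
    (h : A.walshCoeff S ≠ 0) : #S ≤ 2 * n := by
  obtain ⟨I, hI, -⟩ := exists_ne_zero_of_sum_ne_zero h
  rw [← (mem_filter.mp hI).2]
  exact card_support_le I

/-- The K copies use disjoint blocks of signs, so the centred average is a single Walsh combination
whose degree does not grow with K. -/
theorem average_traceEstimate_sub_trace (A : CubeTensor (n + 1) d) {K : ℕ} (hK : K ≠ 0)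
    (ε : Fin K × Fin n × Fin d → Bool) :
    (∑ k, A.traceEstimate fun t i => boolSign (ε (k, t, i))) / (K : ℝ) - A.trace =
      ∑ x : Fin K × {S : Finset (Fin n × Fin d) // S ≠ ∅},
        A.walshCoeff x.2 / K * walsh (x.2.1.map (.sectR x.1 _)) ε := by
  have hK' : (K : ℝ) ≠ 0 := Nat.cast_ne_zero.mpr hK
  have h : ∀ k, (A.traceEstimate fun t i => boolSign (ε (k, t, i))) = A.trace +
      ∑ S : {S : Finset (Fin n × Fin d) // S ≠ ∅},
        A.walshCoeff S * walsh (S.1.map (.sectR k _)) ε := by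
    intro k
    have h1 : ∀ S : Finset (Fin n × Fin d),
        walsh (S.map (.sectR k _)) ε = walsh S fun x => ε (k, x) := fun S => by
      simp [walsh, prod_map]
    rw [A.traceEstimate_eq_sum_walsh fun x => ε (k, x),
      ← sum_filter_add_sum_filter_not univ fun S => S = ∅, filter_eq', if_pos (mem_univ _),
      sum_singleton, walsh_empty, mul_one, walshCoeff_empty]
    simp only [h1]
    congr 1
    exact sum_subtype _ (by simp) fun S => A.walshCoeff S * walsh S fun x => ε (k, x)
  simp only [h, sum_add_distrib, sum_const, card_univ, Fintype.card_fin, nsmul_eq_mul, add_div,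
    mul_div_cancel_left₀ _ hK', add_sub_cancel_left, Fintype.sum_prod_type, sum_div,
    div_mul_eq_mul_div]

/-- The even central moments of the average of `K` trace estimates. -/
theorem expect_average_sub_trace_pow_le (A : CubeTensor (n + 1) d) {K : ℕ} (hK : K ≠ 0) {r : ℕ}
    (hr : r ≠ 0) :
    𝔼 ε : Fin K × Fin n × Fin d → Bool,
      ((∑ k, A.traceEstimate fun t i => boolSign (ε (k, t, i))) / (K : ℝ) - A.trace) ^ (2 * r) ≤
      (((2 * r - 1 : ℕ) : ℝ) ^ (2 * n) *
        (2 * (A.frobeniusNorm ^ 2 - ∑ j, A.diagEntry j ^ 2) / K)) ^ r := by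
  have hK' : (0 : ℝ) < K := Nat.cast_pos.mpr (Nat.pos_of_ne_zero hK)
  simp only [A.average_traceEstimate_sub_trace hK]
  refine (expect_walsh_combination_pow_le r hr (2 * n) _ ?_ _ ?_).trans ?_
  -- A nonempty S reveals its block k, so distinct pairs give distinct Walsh functions.
  · rintro ⟨k, S, hS⟩ ⟨k', S', hS'⟩ h
    dsimp only at h
    obtain ⟨x, hx⟩ := nonempty_iff_ne_empty.mpr hS
    have hx' : (k, x) ∈ S.map (.sectR k _) := mem_map.mpr ⟨x, hx, rfl⟩
    rw [h, mem_map] at hx'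
    obtain ⟨y, -, hy⟩ := hx'
    obtain rfl : k' = k := (Prod.ext_iff.mp hy).1
    simp only [Prod.mk.injEq, Subtype.mk.injEq, true_and]
    exact map_injective _ h
  · intro x hx
    rw [card_map]
    exact card_le_of_walshCoeff_ne_zero (div_ne_zero_iff.mp hx).1
  · gcongr
    rw [Fintype.sum_prod_type]
    simp only [sum_const, card_univ, Fintype.card_fin, nsmul_eq_mul, div_pow, ← sum_div]
    have h : ∑ S : {S : Finset (Fin n × Fin d) // S ≠ ∅}, A.walshCoeff S ^ 2 =
        ∑ S with S ≠ ∅, A.walshCoeff S ^ 2 :=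
      (sum_subtype _ (by simp) fun S => A.walshCoeff S ^ 2).symm
    -- K blocks with squared coefficients divided by K² leave one factor 1/K.
    rw [h, ← mul_div_assoc, sq (K : ℝ), mul_div_mul_left _ _ hK'.ne']
    gcongr
    exact A.sum_walshCoeff_sq_le

theorem variance_traceEstimate (A : CubeTensor (n + 1) d) {Ω : Type*} [MeasurableSpace Ω]
    {μ : Measure Ω} [IsProbabilityMeasure μ] {g : Fin n → Fin d → Ω → ℝ}
    (hg : IsIIDRademacher (fun i : Fin n × Fin d => g i.1 i.2) μ) :
    variance (fun ω => A.traceEstimate fun t i => g t i ω) μ =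
      A.frobeniusNorm ^ 2 - A.trace ^ 2 + 2 * A.crossSum := by
  rw [hg.variance_comp A.measurable_traceEstimate, A.expect_traceEstimate,
    A.expect_traceEstimate_sq, A.sum_support_eq_support]
  ring

theorem variance_traceEstimate_le (A : CubeTensor (n + 1) d) {Ω : Type*} [MeasurableSpace Ω]
    {μ : Measure Ω} [IsProbabilityMeasure μ] {g : Fin n → Fin d → Ω → ℝ}
    (hg : IsIIDRademacher (fun i : Fin n × Fin d => g i.1 i.2) μ) :
    variance (fun ω => A.traceEstimate fun t i => g t i ω) μ ≤
      2 * (A.frobeniusNorm ^ 2 - ∑ j, A.diagEntry j ^ 2) := by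
  refine le_trans (le_of_eq ?_) A.sum_walshCoeff_sq_le
  rw [hg.variance_comp A.measurable_traceEstimate, A.expect_traceEstimate,
    A.expect_traceEstimate_sq_eq_sum_walshCoeff, ← walshCoeff_empty,
    ← sum_filter_add_sum_filter_not univ fun S => S = ∅, filter_eq', if_pos (mem_univ _),
    sum_singleton, add_sub_cancel_left]

theorem isApproximation_average_traceEstimate (A : CubeTensor (n + 1) d) (hA : A.trace ≠ 0)
    {ε δ : ℝ} (hε : 0 < ε) (hδ : 0 < δ) (hδ1 : δ < 1) {K : ℕ} (hK : 1 ≤ K)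
    (hKle : 2 * Real.exp 1 ^ 2 * ((A.frobeniusNorm ^ 2 - ∑ j, A.diagEntry j ^ 2) *
      (2 + Real.log (1 / δ)) ^ (2 * n) / (ε ^ 2 * A.trace ^ 2)) ≤ (K : ℝ))
    {Ω : Type*} [MeasurableSpace Ω] {μ : Measure Ω} [IsProbabilityMeasure μ]
    {g : Fin K → Fin n → Fin d → Ω → ℝ}
    (hg : IsIIDRademacher (fun i : Fin K × Fin n × Fin d => g i.1 i.2.1 i.2.2) μ) :
    IsApproximation (fun ω => (∑ k, A.traceEstimate fun t i => g k t i ω) / (K : ℝ))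
      A.trace ε δ μ := by
  set L := Real.log (1 / δ)
  set D := A.frobeniusNorm ^ 2 - ∑ j, A.diagEntry j ^ 2 with hD
  have hD0 : 0 ≤ D := by
    rw [hD, frobeniusNorm_sq_sub_sum_diagEntry_sq]
    positivity
  have hL : 0 < L := Real.log_pos (by rw [lt_div_iff₀ hδ]; linarith)
  -- The lower bound on 2r makes exp(-2r) ≤ δ; the upper bound keeps 2r - 1 below 2 + L.
  obtain ⟨r, hr, hLr, hrL⟩ : ∃ r : ℕ, r ≠ 0 ∧ L ≤ 2 * r ∧ (2 * r : ℝ) ≤ L + 2 := by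
    refine ⟨⌈L / 2⌉₊, (Nat.ceil_pos.mpr (by positivity)).ne', ?_, ?_⟩
    · linarith [Nat.le_ceil (L / 2)]
    · linarith [Nat.ceil_lt_add_one (show 0 ≤ L / 2 by positivity)]
  have hK' : (0 : ℝ) < K := Nat.cast_pos.mpr hK
  set t := ε * |A.trace|
  have ht : 0 < t := by positivity
  have ht2 : ε ^ 2 * A.trace ^ 2 = t ^ 2 := by rw [mul_pow, sq_abs]
  set F : (Fin K × Fin n × Fin d → ℝ) → ℝ := fun y =>
    (∑ k, A.traceEstimate fun t i => y (k, t, i)) / (K : ℝ) - A.trace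
  have hF : Measurable F := by
    simp only [F, traceEstimate_eq_sum]
    fun_prop
  have hmarkov := hg.measureReal_lt_abs_le hF r ht
  -- In the constant 2e², the 2 comes from the variance bound and e² makes this base at most (t/e)²,
  -- so Markov's inequality yields exp(-2r).
  have hmoment : ((2 * r - 1 : ℕ) : ℝ) ^ (2 * n) * (2 * D / K) ≤ (t * Real.exp (-1)) ^ 2 := by
    have hq : ((2 * r - 1 : ℕ) : ℝ) ≤ 2 + L := by
      rw [Nat.cast_sub (by omega)]
      push_cast
      linarith
    have hq' : ((2 * r - 1 : ℕ) : ℝ) ^ (2 * n) ≤ (2 + L) ^ (2 * n) := by gcongr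
    rw [ht2, ← mul_div_assoc, div_le_iff₀ (by positivity)] at hKle
    rw [← mul_div_assoc, div_le_iff₀ hK', Real.exp_neg, ← div_eq_mul_inv, div_pow,
      div_mul_eq_mul_div, le_div_iff₀ (by positivity)]
    calc ((2 * r - 1 : ℕ) : ℝ) ^ (2 * n) * (2 * D) * Real.exp 1 ^ 2
        ≤ (2 + L) ^ (2 * n) * (2 * D) * Real.exp 1 ^ 2 := by gcongr
      _ = 2 * Real.exp 1 ^ 2 * (D * (2 + L) ^ (2 * n)) := by ring
      _ ≤ t ^ 2 * K := by linarith
  have hbound : μ.real {ω | t < |F fun i => g i.1 i.2.1 i.2.2 ω|} ≤ δ := by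
    refine hmarkov.trans ?_
    rw [div_le_iff₀ (by positivity)]
    calc _ ≤ (((2 * r - 1 : ℕ) : ℝ) ^ (2 * n) * (2 * D / K)) ^ r :=
          A.expect_average_sub_trace_pow_le (by omega) hr
      _ ≤ ((t * Real.exp (-1)) ^ 2) ^ r := by gcongr
      _ = Real.exp (-(2 * r)) * t ^ (2 * r) := by
          rw [← pow_mul, mul_pow, ← Real.exp_nat_mul, mul_comm]
          push_cast
          ring_nf
      _ ≤ δ * t ^ (2 * r) := by
          gcongr
          calc Real.exp (-(2 * r)) ≤ Real.exp (-L) := Real.exp_le_exp.mpr (by linarith)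
            _ = δ := by rw [Real.exp_neg, Real.exp_log (by positivity), one_div, inv_inv]
  have hcover := measureReal_union_le (μ := μ)
    {ω | |F fun i => g i.1 i.2.1 i.2.2 ω| ≤ t} {ω | t < |F fun i => g i.1 i.2.1 i.2.2 ω|}
  rw [show {ω | |F fun i => g i.1 i.2.1 i.2.2 ω| ≤ t} ∪
      {ω | t < |F fun i => g i.1 i.2.1 i.2.2 ω|} = Set.univ from
      Set.eq_univ_of_forall fun ω => le_or_gt _ t, probReal_univ] at hcover
  show 1 - δ ≤ μ.real {ω | |F fun i => g i.1 i.2.1 i.2.2 ω| ≤ t}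
  linarith

end CubeTensor

theorem mainTheorem5 :
    (∀ (n d : ℕ) (A : CubeTensor (n + 1) d)
        (Ω : Type u) [MeasurableSpace Ω] (μ : Measure Ω) [IsProbabilityMeasure μ]
        (g : Fin n → Fin d → Ω → ℝ),
        IsIIDRademacher (fun i : Fin n × Fin d => g i.1 i.2) μ →
        MemLp (fun ω => A.traceEstimate fun t i => g t i ω) 2 μ ∧
        variance (fun ω => A.traceEstimate fun t i => g t i ω) μ
          = A.frobeniusNorm ^ 2 - A.trace ^ 2 + 2 * A.crossSum ∧
        variance (fun ω => A.traceEstimate fun t i => g t i ω) μ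
          ≤ 2 * (A.frobeniusNorm ^ 2 - ∑ j, A.diagEntry j ^ 2)) ∧
    ∃ C : ℝ, 0 < C ∧
      ∀ (n d : ℕ) (A : CubeTensor (n + 1) d), A.trace ≠ 0 →
        ∀ (ε δ : ℝ), 0 < ε → 0 < δ → δ < 1 →
        ∀ (K : ℕ), 1 ≤ K →
        C * ((A.frobeniusNorm ^ 2 - ∑ j, A.diagEntry j ^ 2) *
              (2 + Real.log (1 / δ)) ^ (2 * n) / (ε ^ 2 * A.trace ^ 2)) ≤ (K : ℝ) →
        ∀ (Ω : Type u) [MeasurableSpace Ω] (μ : Measure Ω) [IsProbabilityMeasure μ]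
          (g : Fin K → Fin n → Fin d → Ω → ℝ),
          IsIIDRademacher (fun i : Fin K × Fin n × Fin d => g i.1 i.2.1 i.2.2) μ →
          IsApproximation
            (fun ω => (∑ k, A.traceEstimate fun t i => g k t i ω) / (K : ℝ))
            A.trace ε δ μ := by
  refine ⟨fun n d A Ω _ μ _ g hg => ⟨?_, A.variance_traceEstimate hg,
    A.variance_traceEstimate_le hg⟩, 2 * Real.exp 1 ^ 2, by positivity, ?_⟩
  · exact hg.memLp_comp A.measurable_traceEstimate 2
  · intro n d A hA ε δ hε hδ hδ1 K hK hKle Ω _ μ _ g hg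
    exact A.isApproximation_average_traceEstimate hA hε hδ hδ1 hK hKle hg
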